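/- **Theorem 4.1 (Decomposition on the quadrant).** Give the quadrant $C_2=[0,\infty[^2$, with coordinates $(x,y)$, the subset diffeology of $\mathbf R^2$: a plot of $C_2$ is a smooth map $P:U\to\mathbf R^2$, $U$ an open subset of some $\mathbf R^n$, with values in $C_2$. A (smooth) differential symmetric 2-tensor $\tau$ on $C_2$ assigns to every plot $P:U\to C_2$ a smooth symmetric covariant 2-tensor $\tau(P)$ on $U$ such that $\tau(P\circ F)=F^*(\tau(P))$ for every smooth map $F:V\to U$ between Euclidean domains. A differential symmetric 2-tensor on $C_2$ is called regular if it is the restriction to $C_2$ of a smooth symmetric 2-tensor on $\mathbf R^2$, that is, its pullback by the inclusion. $C^\infty([0,\infty[)$ denotes the restrictions to $[0,\infty[$ of smooth functions on $\mathbf R$. Let $\tau$ be a differential symmetric 2-tensor on $C_2$. 1. There is exactly one triple $(\tau_{\rm reg},A,B)$, with $\tau_{\rm reg}$ a regular tensor on $C_2$ and $A,B\in C^\infty([0,\infty[)$, such that $$\tau=\tau_{\rm reg}+\frac{A(y)}{x}\,dx^2+\frac{B(x)}{y}\,dy^2$$ on the interior $]0,\infty[^2$, i.e. for every plot $P:U\to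 C_2$ the pullbacks by $P$ of the two sides agree at the points of $U$ that $P$ sends into $]0,\infty[^2$. 2. For this triple the equality holds on the whole of $C_2$, in the following sense: there are differential symmetric 2-tensors $\alpha,\beta$ on $C_2$, given by $\frac{A(y)}{x}dx^2$ where $x>0$ and by $\frac{B(x)}{y}dy^2$ where $y>0$ respectively, such that $\tau=\tau_{\rm reg}+\alpha+\beta$. 3. In particular the mixed term of $\tau$ is regular: if $\tau=a\,dx^2+b\,dy^2+2\gamma\,dx\,dy$ on $]0,\infty[^2$, then $\gamma$ is the restriction of a smooth function on $\mathbf R^2$. -/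

import Mathlib

open scoped ContDiff
open Diffeology Set

noncomputable section

/-- The subset diffeology on `s : Set X`: a map into `s` is a plot iff it is a plot of `X` after
composition with the inclusion. -/
instance subsetDiffeology {X : Type*} [DiffeologicalSpace X] (s : Set X) :
    DiffeologicalSpace s where
  plots n := {p : EuclideanSpace ℝ (Fin n) → s | IsPlot (fun r => (p r : X))}
  constant_plots x := isPlot_const
  plot_reparam hp hf := isPlot_reparam hp hf
  locality {n p} hp := by
    refine DiffeologicalSpace.locality (p := fun r => (p r : X)) fun x => ?_
    obtain ⟨u, hu, hxu, h⟩ := hp x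
    exact ⟨u, hu, hxu, fun hf hf' => h hf hf'⟩

/-- A (smooth) differential symmetric covariant 2-tensor on a diffeological space `X`: to every
plot `P : ℝⁿ → X` it assigns a smooth field of symmetric bilinear forms on `ℝⁿ`, in such a way that
`τ(P ∘ F) = F^*(τ(P))` for every smooth reparametrization `F : ℝᵐ → ℝⁿ`.
Plots are defined on all of `ℝⁿ`, as in Mathlib's `DiffeologicalSpace`; since every point of an open
set has a neighbourhood diffeomorphic to `ℝⁿ`, this gives the same tensors as families indexed by
plots on open subsets of the spaces `ℝⁿ`. -/
@[ext]
structure DiffSymTensor (X : Type*) [DiffeologicalSpace X] where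
  /-- The value of the tensor on a plot `P`, at a point of its domain. -/
  val : ∀ {n : ℕ} (P : EuclideanSpace ℝ (Fin n) → X), IsPlot P →
    EuclideanSpace ℝ (Fin n) →
      EuclideanSpace ℝ (Fin n) →L[ℝ] EuclideanSpace ℝ (Fin n) →L[ℝ] ℝ
  smooth : ∀ {n : ℕ} (P : EuclideanSpace ℝ (Fin n) → X) (hP : IsPlot P),
    ContDiff ℝ ∞ (val P hP)
  symm : ∀ {n : ℕ} (P : EuclideanSpace ℝ (Fin n) → X) (hP : IsPlot P)
    (r v w : EuclideanSpace ℝ (Fin n)), val P hP r v w = val P hP r w v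
  pullback : ∀ {m n : ℕ} (P : EuclideanSpace ℝ (Fin n) → X) (hP : IsPlot P)
    (F : EuclideanSpace ℝ (Fin m) → EuclideanSpace ℝ (Fin n)) (hF : ContDiff ℝ ∞ F)
    (r v w : EuclideanSpace ℝ (Fin m)),
    val (P ∘ F) (isPlot_reparam hP hF) r v w =
      val P hP (F r) (fderiv ℝ F r v) (fderiv ℝ F r w)

/-- The sum of two tensors, computed plot by plot. -/
instance {X : Type*} [DiffeologicalSpace X] : Add (DiffSymTensor X) where
  add τ σ :=
    { val := fun P hP r => τ.val P hP r + σ.val P hP r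
      smooth := fun P hP => (τ.smooth P hP).add (σ.smooth P hP)
      symm := fun P hP r v w => by simp [τ.symm P hP r v w, σ.symm P hP r v w]
      pullback := fun P hP F hF r v w => by
        simp [τ.pullback P hP F hF r v w, σ.pullback P hP F hF r v w] }

/-- A smooth symmetric 2-tensor on the Euclidean space `ℝᵏ`, in the usual sense. -/
structure SmoothSymTensorField (k : ℕ) where
  val : EuclideanSpace ℝ (Fin k) →
    EuclideanSpace ℝ (Fin k) →L[ℝ] EuclideanSpace ℝ (Fin k) →L[ℝ] ℝ
  smooth : ContDiff ℝ ∞ val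
  symm : ∀ p v w, val p v w = val p w v

/-- The restriction of a smooth symmetric 2-tensor `σ` on `ℝᵏ` to a subset `s`, i.e. its pullback by
the inclusion `s → ℝᵏ`: its value on a plot `P` of `s` is the usual pullback `P^*(σ)`. -/
def SmoothSymTensorField.restrict {k : ℕ} (σ : SmoothSymTensorField k)
    (s : Set (EuclideanSpace ℝ (Fin k))) : DiffSymTensor s where
  val {n} P _ r :=
    (σ.val (P r : EuclideanSpace ℝ (Fin k))).bilinearComp
      (fderiv ℝ (fun t => (P t : EuclideanSpace ℝ (Fin k))) r)
      (fderiv ℝ (fun t => (P t : EuclideanSpace ℝ (Fin k))) r)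
  smooth {n} P hP := by
    have h : ContDiff ℝ ∞ (fun t => (P t : EuclideanSpace ℝ (Fin k))) :=
      isPlot_iff_contDiff.1 hP
    have h' : ContDiff ℝ ∞ (fderiv ℝ (fun t => (P t : EuclideanSpace ℝ (Fin k)))) :=
      h.fderiv_right (by simp)
    rw [contDiff_clm_apply_iff]
    intro v
    rw [contDiff_clm_apply_iff]
    intro w
    exact ((σ.smooth.comp h).clm_apply (h'.clm_apply contDiff_const)).clm_apply
      (h'.clm_apply contDiff_const)
  symm P hP r v w := σ.symm _ _ _
  pullback {m n} P hP F hF r v w := by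
    have h : ContDiff ℝ ∞ (fun t => (P t : EuclideanSpace ℝ (Fin k))) :=
      isPlot_iff_contDiff.1 hP
    have e : fderiv ℝ (fun t => ((P ∘ F) t : EuclideanSpace ℝ (Fin k))) r =
        (fderiv ℝ (fun t => (P t : EuclideanSpace ℝ (Fin k))) (F r)).comp (fderiv ℝ F r) :=
      fderiv_comp r (h.differentiable (by simp) _) (hF.differentiable (by simp) _)
    simp only [ContinuousLinearMap.bilinearComp_apply, e]
    rfl

/-- The quadrant `C₂ = [0, ∞[²` in `ℝ²`. It carries the subset diffeology. -/
def quadrant : Set (EuclideanSpace ℝ (Fin 2)) := {p | 0 ≤ p 0 ∧ 0 ≤ p 1}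

/-- The coordinate `x` (for `i = 0`) or `y` (for `i = 1`) on the quadrant, with values in
`[0, ∞[`. -/
def quadrantCoord (i : Fin 2) (p : quadrant) : Ici (0 : ℝ) :=
  ⟨(p : EuclideanSpace ℝ (Fin 2)) i, by
    fin_cases i
    · exact p.2.1
    · exact p.2.2⟩

/-- The pullback by `P` of the differential `dx` (for `i = 0`) or `dy` (for `i = 1`), at `r`,
evaluated on the vector `v`. -/
def coordDiff (i : Fin 2) {n : ℕ} (P : EuclideanSpace ℝ (Fin n) → quadrant)
    (r v : EuclideanSpace ℝ (Fin n)) : ℝ :=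
  fderiv ℝ (fun t => (quadrantCoord i (P t) : ℝ)) r v

/-- The value at `r`, on `(v, w)`, of the pullback by `P` of the expression `(A(y)/x) dx ⊗ dx`.
It is used only where `x (P r) > 0`. -/
def axialX (A : Ici (0 : ℝ) → ℝ) {n : ℕ} (P : EuclideanSpace ℝ (Fin n) → quadrant)
    (r v w : EuclideanSpace ℝ (Fin n)) : ℝ :=
  A (quadrantCoord 1 (P r)) / (quadrantCoord 0 (P r) : ℝ) * (coordDiff 0 P r v * coordDiff 0 P r w)

/-- The value at `r`, on `(v, w)`, of the pullback by `P` of the expression `(B(x)/y) dy ⊗ dy`.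
It is used only where `y (P r) > 0`. -/
def axialY (B : Ici (0 : ℝ) → ℝ) {n : ℕ} (P : EuclideanSpace ℝ (Fin n) → quadrant)
    (r v w : EuclideanSpace ℝ (Fin n)) : ℝ :=
  B (quadrantCoord 0 (P r)) / (quadrantCoord 1 (P r) : ℝ) * (coordDiff 1 P r v * coordDiff 1 P r w)

/-- `f` belongs to `C^∞([0, ∞[)`: it is the restriction of a smooth function on `ℝ`. -/
def SmoothOnHalfLine (f : Ici (0 : ℝ) → ℝ) : Prop :=
  ∃ g : ℝ → ℝ, ContDiff ℝ ∞ g ∧ ∀ x : Ici (0 : ℝ), g x = f x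

/-- A tensor on the quadrant is regular if it is the restriction of a smooth symmetric 2-tensor
on `ℝ²`. -/
def IsRegularTensor (τ : DiffSymTensor quadrant) : Prop :=
  ∃ σ : SmoothSymTensorField 2, τ = σ.restrict quadrant

/-- `τ = ρ + (A(y)/x) dx² + (B(x)/y) dy²` on the interior `]0, ∞[²`, with `ρ` regular and `A`, `B`
in `C^∞([0, ∞[)`. Equality on the interior is tested on all plots, at the points sent to it. -/
structure IsDecomposition (τ ρ : DiffSymTensor quadrant) (A B : Ici (0 : ℝ) → ℝ) : Prop where
  regular : IsRegularTensor ρ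
  smooth_A : SmoothOnHalfLine A
  smooth_B : SmoothOnHalfLine B
  eq_interior : ∀ {n : ℕ} (P : EuclideanSpace ℝ (Fin n) → quadrant) (hP : IsPlot P)
    (r v w : EuclideanSpace ℝ (Fin n)),
    0 < (quadrantCoord 0 (P r) : ℝ) → 0 < (quadrantCoord 1 (P r) : ℝ) →
    τ.val P hP r v w = ρ.val P hP r v w + axialX A P r v w + axialY B P r v w

/-- The tensor `α` on the quadrant is `(A(y)/x) dx²`: it is given by this expression wherever
`x > 0`. -/
def IsAxialX (α : DiffSymTensor quadrant) (A : Ici (0 : ℝ) → ℝ) : Prop :=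
  ∀ {n : ℕ} (P : EuclideanSpace ℝ (Fin n) → quadrant) (hP : IsPlot P)
    (r v w : EuclideanSpace ℝ (Fin n)),
    0 < (quadrantCoord 0 (P r) : ℝ) → α.val P hP r v w = axialX A P r v w

/-- The tensor `β` on the quadrant is `(B(x)/y) dy²`: it is given by this expression wherever
`y > 0`. -/
def IsAxialY (β : DiffSymTensor quadrant) (B : Ici (0 : ℝ) → ℝ) : Prop :=
  ∀ {n : ℕ} (P : EuclideanSpace ℝ (Fin n) → quadrant) (hP : IsPlot P)
    (r v w : EuclideanSpace ℝ (Fin n)),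
    0 < (quadrantCoord 1 (P r) : ℝ) → β.val P hP r v w = axialY B P r v w

/-- The mixed coefficient `γ = τ(∂/∂x, ∂/∂y)` of `τ = α dx² + β dy² + 2γ dx dy`, a priori a function
on the interior of the quadrant, is regular: it is the restriction of a smooth function on `ℝ²`. -/
def HasRegularMixedTerm (τ : DiffSymTensor quadrant) : Prop :=
  ∃ γ : EuclideanSpace ℝ (Fin 2) → ℝ, ContDiff ℝ ∞ γ ∧
    ∀ {n : ℕ} (P : EuclideanSpace ℝ (Fin n) → quadrant) (hP : IsPlot P)
      (r v w : EuclideanSpace ℝ (Fin n)),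
      0 < (quadrantCoord 0 (P r) : ℝ) → 0 < (quadrantCoord 1 (P r) : ℝ) →
      coordDiff 0 P r v = 1 → coordDiff 1 P r v = 0 →
      coordDiff 0 P r w = 0 → coordDiff 1 P r w = 1 →
      τ.val P hP r v w = γ (P r : EuclideanSpace ℝ (Fin 2))

end

/-!
Every differential symmetric 2-tensor `τ` on the quadrant is regular, so that the decomposition is
`τ = τ + 0 + 0`; the functions `A` and `B` always vanish. Indeed `(A(y)/x) dx²` with `A ≠ 0` is not
a tensor on the quadrant: pulled back by `x = u² + v²` it is
`4 A (u du + v dv)² / (u² + v²)`, which has no limit at `u = v = 0` when `A ≠ 0` there.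

The same plot proves regularity. On the interior, `τ = ∑ mᵢⱼ dxᵢ dxⱼ` for some functions `mᵢⱼ`
(`val_eq_sum_interiorCoeff`: every plot lifts locally through the folding plot `(s², t²)`).
The pullback of `m₀₀ dx²` by `(u² + v², t²)` has mixed coefficient `4 u v m₀₀(u² + v², t²)`. This is a
smooth function of `(u, v, t)`, odd in `u` and in `v` and even in `t`, hence of the form
`u v g(u², v², t²)` with `g` smooth on `ℝ³`; therefore `m₀₀(x, y) = g(x/2, x/2, y) / 4` extends
smoothly to `ℝ²` (`exists_contDiff_eq_interiorCoeff_self`). The mixed coefficient `m₀₁` is obtained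
in the same way from the folding plot. The tensor on `ℝ²` with these coefficients agrees with `τ` at
the interior points of all plots, hence everywhere (`DiffSymTensor.eq_of_eq_interior`).

The analytic tool is Whitney's theorem on even functions, with several variables and for either
parity (`exists_contDiff_comp_coordSq`). A partition of unity reduces it to compactly supported
functions. These are integrals of products of `cos (ξ s)` and `sin (ξ s)` against their Fourier
transform, which is rapidly decreasing. Now `cos s = φ(s²)` and `sin s = s ψ(s²)` with `φ`, `ψ` smooth
on `ℝ` and of temperate growth, so that replacing `s²` by a real variable in `φ(ξ² s²)` and
`ψ(ξ² s²)` under the integral gives the desired smooth function.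

For uniqueness, evaluate a decomposition on `(∂ₛ, ∂ₛ)` along the folding plot: the axial term
contributes `4 A(t²)`, and the regular tensors `τ` and `ρ` contribute terms that vanish as `s → 0`
(`IsDecomposition.eq_zero`).
-/

theorem Function.HasTemperateGrowth.fderiv {E F : Type*} [NormedAddCommGroup E] [NormedSpace ℝ E]
    [NormedAddCommGroup F] [NormedSpace ℝ F] {f : E → F} (hf : f.HasTemperateGrowth) :
    (fderiv ℝ f).HasTemperateGrowth := by
  refine ⟨hf.1.fderiv_right (by simp), fun n => ?_⟩
  obtain ⟨k, C, h⟩ := hf.2 (n + 1)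
  exact ⟨k, C, fun x => by rw [norm_iteratedFDeriv_fderiv]; exact h x⟩

/-! ### The cosine as a function of the square -/

section Kernel

open Polynomial Filter Topology

/-- The power series of `cos √u` has infinite radius of convergence. -/
theorem exists_contDiff_cos_sq :
    ∃ c : ℝ → ℝ, ContDiff ℝ ∞ c ∧ ∀ s, c (s ^ 2) = Real.cos s := by
  let a : ℕ → ℝ := fun n => (-1) ^ n / ((2 * n).factorial : ℝ)
  have hr : (FormalMultilinearSeries.ofScalars ℝ a).radius = ⊤ := by
    apply FormalMultilinearSeries.ofScalars_radius_eq_top_of_tendsto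
    · refine Eventually.of_forall fun n => ?_
      simp only [a]
      positivity
    · have h : ∀ n : ℕ, ‖a n.succ‖ / ‖a n‖ = ((2 * (n : ℝ) + 2) * (2 * n + 1))⁻¹ := by
        intro n
        have : ((2 * (n + 1)).factorial : ℝ) =
            (2 * (n : ℝ) + 2) * ((2 * n + 1) * ((2 * n).factorial : ℝ)) := by
          rw [show 2 * (n + 1) = 2 * n + 1 + 1 by ring, Nat.factorial_succ, Nat.factorial_succ]
          push_cast
          ring
        have h0 : ((2 * n).factorial : ℝ) ≠ 0 := by positivity
        simp only [a, Nat.succ_eq_add_one, norm_div, norm_pow, norm_neg, norm_one, one_pow,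
          Real.norm_natCast, this, norm_mul]
        rw [Real.norm_of_nonneg (show (0 : ℝ) ≤ 2 * n + 2 by positivity),
          Real.norm_of_nonneg (show (0 : ℝ) ≤ 2 * n + 1 by positivity)]
        field_simp
      simp_rw [h]
      refine squeeze_zero (fun n => by positivity) (fun n => ?_)
        (tendsto_one_div_add_atTop_nhds_zero_nat (𝕜 := ℝ))
      rw [← one_div]
      apply one_div_le_one_div_of_le (by positivity)
      nlinarith [(Nat.cast_nonneg n : (0 : ℝ) ≤ n)]
  have hs := (FormalMultilinearSeries.ofScalars ℝ a).hasFPowerSeriesOnBall (by simp [hr])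
  refine ⟨(FormalMultilinearSeries.ofScalars ℝ a).sum, ?_, fun s => ?_⟩
  · have := hs.analyticOnNhd
    rw [hr] at this
    exact contDiff_iff_contDiffAt.2 fun x => (this x (by simp)).contDiffAt
  · have h1 := (Real.hasSum_cos s).tsum_eq
    rw [← h1]
    refine tsum_congr fun n => ?_
    rw [FormalMultilinearSeries.ofScalars_apply_eq]
    simp only [a, smul_eq_mul, ← pow_mul]
    ring

/-- On `]0, ∞[` every derivative of `cos √u` is a combination of `cos √u` and `sin √u` with
coefficients polynomial in `1 / √u`. -/
theorem iteratedDeriv_cos_sqrt {c : ℝ → ℝ} (hc : ∀ s, 0 < s → c (s ^ 2) = Real.cos s) (n : ℕ) :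
    ∃ p q : ℝ[X], ∀ u, 0 < u → iteratedDeriv n c u =
      p.eval (√u)⁻¹ * Real.cos √u + q.eval (√u)⁻¹ * Real.sin √u := by
  induction n with
  | zero =>
    refine ⟨1, 0, fun u hu => ?_⟩
    simp [← hc _ (Real.sqrt_pos.2 hu), Real.sq_sqrt hu.le]
  | succ n ih =>
    obtain ⟨p, q, h⟩ := ih
    refine ⟨C (-(1 / 2)) * X ^ 3 * derivative p + C (1 / 2) * X * q,
      C (-(1 / 2)) * X ^ 3 * derivative q - C (1 / 2) * X * p, fun u hu => ?_⟩
    have hs : 0 < √u := Real.sqrt_pos.2 hu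
    have h1 : HasDerivAt Real.sqrt (1 / (2 * √u)) u := Real.hasDerivAt_sqrt hu.ne'
    have h2 : HasDerivAt (fun u => (√u)⁻¹) (-(1 / (2 * √u)) / √u ^ 2) u := h1.fun_inv hs.ne'
    have hp := HasDerivAt.comp u (p.hasDerivAt (√u)⁻¹) h2
    have hq := HasDerivAt.comp u (q.hasDerivAt (√u)⁻¹) h2
    have h3 := (hp.fun_mul h1.cos).fun_add (hq.fun_mul h1.sin)
    rw [iteratedDeriv_succ]
    have he : iteratedDeriv n c =ᶠ[𝓝 u] fun u =>
        p.eval (√u)⁻¹ * Real.cos √u + q.eval (√u)⁻¹ * Real.sin √u := by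
      filter_upwards [lt_mem_nhds hu] with v hv using h v hv
    rw [(h3.congr_of_eventuallyEq he).deriv]
    simp only [Function.comp_apply, eval_add, eval_sub, eval_mul, eval_C, eval_X, eval_pow]
    field_simp
    ring

theorem exists_bound_of_continuous {g : ℝ → ℝ} (hg : Continuous g) {K : ℝ}
    (h0 : ∀ u < -1, g u = 0) (h1 : ∀ u, 1 < u → |g u| ≤ K) : ∃ C, ∀ u, |g u| ≤ C := by
  obtain ⟨D, hD⟩ := (isCompact_Icc (a := (-1 : ℝ)) (b := 1)).exists_bound_of_continuousOn
    hg.continuousOn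
  refine ⟨max (max D K) 0, fun u => ?_⟩
  rcases lt_or_ge u (-1) with h | h
  · simp [h0 u h]
  rcases le_or_gt u 1 with h' | h'
  · exact (hD u ⟨h, h'⟩).trans (by simp)
  · exact (h1 u h').trans (by simp)

/-- A function of temperate growth on the whole line which is `cos √u` for `u ≥ 0`: the entire
function `cos √u` grows exponentially at `-∞`, so it is cut off there. -/
theorem exists_temperate_cos_sq :
    ∃ φ : ℝ → ℝ, φ.HasTemperateGrowth ∧ ∀ s, φ (s ^ 2) = Real.cos s := by
  obtain ⟨c, hc, hcs⟩ := exists_contDiff_cos_sq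
  let φ : ℝ → ℝ := fun u => Real.smoothTransition (u + 1) * c u
  have hφ : ContDiff ℝ ∞ φ :=
    (Real.smoothTransition.contDiff.comp (contDiff_id.add contDiff_const)).mul hc
  have hφs : ∀ s, φ (s ^ 2) = Real.cos s := fun s => by
    simp only [φ, hcs]
    rw [Real.smoothTransition.one_of_one_le (by nlinarith [sq_nonneg s]), one_mul]
  refine ⟨φ, ⟨hφ, fun n => ?_⟩, hφs⟩
  obtain ⟨p, q, hpq⟩ := iteratedDeriv_cos_sqrt (fun s _ => hφs s) n
  obtain ⟨K, hK⟩ := (isCompact_Icc (a := (0 : ℝ)) (b := 1)).exists_bound_of_continuousOn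
    p.continuous.continuousOn
  obtain ⟨L, hL⟩ := (isCompact_Icc (a := (0 : ℝ)) (b := 1)).exists_bound_of_continuousOn
    q.continuous.continuousOn
  have hcont : Continuous (iteratedDeriv n φ) :=
    hφ.continuous_iteratedDeriv n (mod_cast le_top)
  obtain ⟨C, hC⟩ := exists_bound_of_continuous (K := K + L) hcont
    (fun u hu => by
      have he : φ =ᶠ[𝓝 u] fun _ => 0 := by
        filter_upwards [gt_mem_nhds hu] with v hv
        simp [φ, Real.smoothTransition.zero_of_nonpos (show v + 1 ≤ 0 by linarith)]
      rw [he.iteratedDeriv_eq n]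
      simp)
    (fun u hu => by
      rw [hpq u (by linarith)]
      have h1 : (√u)⁻¹ ∈ Set.Icc (0 : ℝ) 1 :=
        ⟨by positivity, inv_le_one_of_one_le₀ (Real.one_le_sqrt.2 hu.le)⟩
      have h2 := hK _ h1
      have h3 := hL _ h1
      rw [Real.norm_eq_abs] at h2 h3
      refine (abs_add_le _ _).trans (add_le_add ?_ ?_)
      · rw [abs_mul]
        exact (mul_le_of_le_one_right (abs_nonneg _) (Real.abs_cos_le_one _)).trans h2
      · rw [abs_mul]
        exact (mul_le_of_le_one_right (abs_nonneg _) (Real.abs_sin_le_one _)).trans h3)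
  refine ⟨0, C, fun u => ?_⟩
  rw [norm_iteratedFDeriv_eq_norm_iteratedDeriv]
  simpa using hC u

/-- The odd counterpart of `exists_temperate_cos_sq`, obtained by differentiating it. -/
theorem exists_temperate_sin_sq :
    ∃ ψ : ℝ → ℝ, ψ.HasTemperateGrowth ∧ ∀ s, s * ψ (s ^ 2) = Real.sin s := by
  obtain ⟨φ, hφ, hs⟩ := exists_temperate_cos_sq
  have hd : Function.HasTemperateGrowth (deriv φ) := by
    have h1 : Function.HasTemperateGrowth (fderiv ℝ φ) := hφ.fderiv
    have h2 : deriv φ = fun x => ContinuousLinearMap.apply ℝ ℝ (1 : ℝ) (fderiv ℝ φ x) := by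
      ext x; simp
    rw [h2]
    exact (ContinuousLinearMap.hasTemperateGrowth _).comp h1
  refine ⟨fun u => -2 * deriv φ u, by fun_prop, fun s => ?_⟩
  have h1 : HasDerivAt (fun s => φ (s ^ 2)) _ s :=
    HasDerivAt.comp s (hφ.1.differentiable (by simp) (s ^ 2)).hasDerivAt (hasDerivAt_pow 2 s)
  simp_rw [hs] at h1
  have h2 := h1.unique (Real.hasDerivAt_cos s)
  simp only [Nat.cast_ofNat, Nat.add_one_sub_one, pow_one] at h2
  linarith

end Kernel

/-! ### Integrals with a parameter -/

section ParametricIntegral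

open MeasureTheory

theorem exists_bound_smul_temperate {E V G : Type*} [NormedAddCommGroup E] [NormedSpace ℝ E]
    [NormedAddCommGroup V] [NormedSpace ℝ V] [NormedAddCommGroup G] [NormedSpace ℝ G]
    (h : V → ℝ) {L : E × V → G} (hL : L.HasTemperateGrowth) (x₀ : E) :
    ∃ (k : ℕ) (C : ℝ), ∀ x ∈ Metric.ball x₀ 1, ∀ ξ,
      ‖h ξ • L (x, ξ)‖ ≤ C * ((1 + ‖ξ‖) ^ k * ‖h ξ‖) := by
  obtain ⟨k, C, hC0, hC⟩ := hL.norm_iteratedFDeriv_le_uniform 0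
  refine ⟨k, C * (2 + ‖x₀‖) ^ k, fun x hx ξ => ?_⟩
  have h1 := hC 0 le_rfl (x, ξ)
  rw [norm_iteratedFDeriv_zero] at h1
  have hx' : ‖x‖ ≤ ‖x₀‖ + 1 := by
    have := norm_le_norm_add_norm_sub' x x₀
    rw [mem_ball_iff_norm] at hx
    linarith
  have h2 : 1 + ‖(x, ξ)‖ ≤ (2 + ‖x₀‖) * (1 + ‖ξ‖) := by
    have : ‖(x, ξ)‖ ≤ ‖x‖ + ‖ξ‖ := by
      rw [Prod.norm_def]
      exact max_le (by simp) (by simp)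
    nlinarith [norm_nonneg ξ, norm_nonneg x₀]
  rw [norm_smul]
  calc ‖h ξ‖ * ‖L (x, ξ)‖ ≤ ‖h ξ‖ * (C * ((2 + ‖x₀‖) * (1 + ‖ξ‖)) ^ k) := by
        gcongr
        exact h1.trans (by gcongr)
    _ = _ := by rw [mul_pow]; ring

/-- Integrals of a kernel of temperate growth against a rapidly decreasing weight may be
differentiated under the integral sign. -/
theorem hasFDerivAt_integral_temperate {E V G : Type*} [NormedAddCommGroup E] [NormedSpace ℝ E]
    [NormedAddCommGroup V] [NormedSpace ℝ V] [FiniteDimensional ℝ V] [MeasurableSpace V]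
    [BorelSpace V] {μ : Measure V} [NormedAddCommGroup G] [NormedSpace ℝ G] {h : V → ℝ}
    (hc : Continuous h) (hi : ∀ k : ℕ, Integrable (fun ξ => (1 + ‖ξ‖) ^ k * ‖h ξ‖) μ)
    {K : E × V → G} (hK : K.HasTemperateGrowth) (x₀ : E) :
    HasFDerivAt (fun x => ∫ ξ, h ξ • K (x, ξ) ∂μ)
      (∫ ξ, h ξ • (fderiv ℝ K (x₀, ξ)).comp (ContinuousLinearMap.inl ℝ E V) ∂μ) x₀ := by
  have hK' : Function.HasTemperateGrowth fun p : E × V =>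
      (fderiv ℝ K p).comp (ContinuousLinearMap.inl ℝ E V) :=
    ((ContinuousLinearMap.compL ℝ E (E × V) G).flip
      (ContinuousLinearMap.inl ℝ E V)).hasTemperateGrowth.comp hK.fderiv
  obtain ⟨k, C, hkC⟩ := exists_bound_smul_temperate h hK x₀
  obtain ⟨k', C', hkC'⟩ := exists_bound_smul_temperate h hK' x₀
  have hm : ∀ x, AEStronglyMeasurable (fun ξ => h ξ • K (x, ξ)) μ := fun x =>
    (hc.smul (hK.1.continuous.comp (by fun_prop))).aestronglyMeasurable
  refine hasFDerivAt_integral_of_dominated_of_fderiv_le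
    (F' := fun x ξ => h ξ • (fderiv ℝ K (x, ξ)).comp (ContinuousLinearMap.inl ℝ E V))
    (Metric.ball_mem_nhds x₀ one_pos)
    (Filter.Eventually.of_forall hm)
    (((hi k).const_mul C).mono' (hm x₀) (Filter.Eventually.of_forall fun ξ =>
      hkC x₀ (Metric.mem_ball_self one_pos) ξ))
    (hc.smul (hK'.1.continuous.comp (by fun_prop))).aestronglyMeasurable
    (Filter.Eventually.of_forall fun ξ x hx => hkC' x hx ξ)
    ((hi k').const_mul C')
    (Filter.Eventually.of_forall fun ξ x _ => ?_)
  have h1 : HasFDerivAt (fun x : E => (x, ξ)) (ContinuousLinearMap.inl ℝ E V) x :=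
    hasFDerivAt_prodMk_left x ξ
  exact ((hK.1.differentiable (by simp) (x, ξ)).hasFDerivAt.comp x h1).const_smul (h ξ)

theorem contDiff_integral_temperate {E V G : Type} [NormedAddCommGroup E] [NormedSpace ℝ E]
    [NormedAddCommGroup V] [NormedSpace ℝ V] [FiniteDimensional ℝ V] [MeasurableSpace V]
    [BorelSpace V] {μ : Measure V} [NormedAddCommGroup G] [NormedSpace ℝ G] {h : V → ℝ}
    (hc : Continuous h) (hi : ∀ k : ℕ, Integrable (fun ξ => (1 + ‖ξ‖) ^ k * ‖h ξ‖) μ)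
    {K : E × V → G} (hK : K.HasTemperateGrowth) :
    ContDiff ℝ ∞ (fun x => ∫ ξ, h ξ • K (x, ξ) ∂μ) := by
  refine contDiff_infty.2 fun n => ?_
  induction n generalizing G with
  | zero =>
    exact contDiff_zero.2 (continuous_iff_continuousAt.2 fun x =>
      (hasFDerivAt_integral_temperate hc hi hK x).continuousAt)
  | succ n ih =>
    have hK' : Function.HasTemperateGrowth fun p : E × V =>
        (fderiv ℝ K p).comp (ContinuousLinearMap.inl ℝ E V) :=
      ((ContinuousLinearMap.compL ℝ E (E × V) G).flip
        (ContinuousLinearMap.inl ℝ E V)).hasTemperateGrowth.comp hK.fderiv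
    exact contDiff_succ_iff_hasFDerivAt.2
      ⟨_, ih hK', hasFDerivAt_integral_temperate hc hi hK⟩

end ParametricIntegral

/-! ### Smooth functions of given parity in each coordinate -/

section Parity

open MeasureTheory FourierTransform

/-- The map `(s₁, …, sₙ) ↦ (s₁², …, sₙ²)`. -/
def coordSq {n : ℕ} (s : EuclideanSpace ℝ (Fin n)) : EuclideanSpace ℝ (Fin n) :=
  WithLp.toLp 2 fun i => s i ^ 2

/-- The reflection changing the sign of the `j`-th coordinate. -/
def coordNeg {n : ℕ} (j : Fin n) (s : EuclideanSpace ℝ (Fin n)) : EuclideanSpace ℝ (Fin n) :=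
  WithLp.toLp 2 (Function.update s j (-s j))

theorem coordSq_apply {n : ℕ} (s : EuclideanSpace ℝ (Fin n)) (i : Fin n) :
    coordSq s i = s i ^ 2 := rfl

theorem coordNeg_self {n : ℕ} (j : Fin n) (s : EuclideanSpace ℝ (Fin n)) :
    coordNeg j s j = -s j := by simp [coordNeg]

theorem coordNeg_of_ne {n : ℕ} {i j : Fin n} (h : i ≠ j) (s : EuclideanSpace ℝ (Fin n)) :
    coordNeg j s i = s i := by simp [coordNeg, h]

theorem coordSq_coordNeg {n : ℕ} (j : Fin n) (s : EuclideanSpace ℝ (Fin n)) :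
    coordSq (coordNeg j s) = coordSq s := by
  ext i
  rw [coordSq_apply, coordSq_apply]
  rcases eq_or_ne i j with rfl | h
  · rw [coordNeg_self, neg_sq]
  · rw [coordNeg_of_ne h]

theorem contDiff_coordSq {n : ℕ} : ContDiff ℝ ∞ (coordSq (n := n)) := by
  rw [contDiff_euclidean]
  intro i
  simp only [coordSq_apply]
  fun_prop

/-- The part of `exp (i t)` of parity `d` in `t`: `cos t` for even `d` and `i sin t` for odd `d`. -/
noncomputable def parityExp (d : ℕ) (t : ℝ) : ℂ :=
  (Complex.exp (t * Complex.I) + (-1) ^ d * Complex.exp (-t * Complex.I)) / 2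

theorem norm_parityExp_le (d : ℕ) (t : ℝ) : ‖parityExp d t‖ ≤ 1 := by
  have h : ‖Complex.exp (t * Complex.I) + (-1) ^ d * Complex.exp (-t * Complex.I)‖ ≤ 1 + 1 := by
    refine (norm_add_le _ _).trans (add_le_add ?_ ?_)
    · rw [Complex.norm_exp_ofReal_mul_I]
    · rw [norm_mul, ← Complex.ofReal_neg, Complex.norm_exp_ofReal_mul_I]
      simp
  rw [parityExp, norm_div]
  norm_num at h ⊢
  linarith

theorem continuous_parityExp (d : ℕ) : Continuous (parityExp d) := by
  unfold parityExp
  fun_prop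

/-- The symmetrised exponential is a smooth function of the square of the variable, up to the
factor `t` in the odd case. -/
theorem exists_temperate_parityExp {d : ℕ} (hd : d < 2) :
    ∃ χ : ℝ → ℝ, χ.HasTemperateGrowth ∧
      ∀ t : ℝ, parityExp d t = Complex.I ^ d * ((t ^ d * χ (t ^ 2) : ℝ) : ℂ) := by
  interval_cases d
  · obtain ⟨φ, hφ, h⟩ := exists_temperate_cos_sq
    refine ⟨φ, hφ, fun t => ?_⟩
    rw [h]
    simp [parityExp, Complex.cos]
  · obtain ⟨ψ, hψ, h⟩ := exists_temperate_sin_sq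
    refine ⟨ψ, hψ, fun t => ?_⟩
    rw [pow_one t, h]
    simp only [parityExp, pow_one, Complex.ofReal_sin, Complex.sin]
    linear_combination (Complex.exp (t * Complex.I) - Complex.exp (-t * Complex.I)) / 2 *
      Complex.I_sq

/-- In the Fourier representation of a function of parity `d i` in the `i`-th coordinate, the
exponentials may be symmetrised, one coordinate at a time. -/
theorem fourier_symmetrize {n : ℕ} {d : Fin n → ℕ} {f : EuclideanSpace ℝ (Fin n) → ℂ}
    {h : EuclideanSpace ℝ (Fin n) → ℂ} (hint : Integrable h)
    (hf : ∀ s, f s = ∫ ξ, h ξ * ∏ i, Complex.exp (((2 * Real.pi * ξ i * s i : ℝ) : ℂ) * Complex.I))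
    (hpar : ∀ j s, f (coordNeg j s) = (-1) ^ d j * f s) (s : EuclideanSpace ℝ (Fin n)) :
    f s = ∫ ξ, h ξ * ∏ i, parityExp (d i) (2 * Real.pi * ξ i * s i) := by
  classical
  let k : Finset (Fin n) → Fin n → ℝ → ℂ := fun S i t =>
    if i ∈ S then parityExp (d i) t else Complex.exp (t * Complex.I)
  have hk1 : ∀ S i t, ‖k S i t‖ ≤ 1 := by
    intro S i t
    by_cases hi : i ∈ S
    · simp only [k, hi, if_true]
      exact norm_parityExp_le _ _
    · simp only [k, hi, if_false]
      rw [Complex.norm_exp_ofReal_mul_I]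
  have hkc : ∀ S i, Continuous (k S i) := by
    intro S i
    by_cases hi : i ∈ S
    · simp only [k, hi, if_true]
      exact continuous_parityExp _
    · simp only [k, hi, if_false]
      fun_prop
  have hI : ∀ S (s : EuclideanSpace ℝ (Fin n)),
      Integrable fun ξ : EuclideanSpace ℝ (Fin n) => h ξ * ∏ i, k S i (2 * Real.pi * ξ i * s i) := by
    intro S s
    refine hint.mul_bdd (c := 1) ?_ (Filter.Eventually.of_forall fun ξ => ?_)
    · exact (continuous_finsetProd _ fun i _ => (hkc S i).comp
        (by fun_prop)).aestronglyMeasurable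
    · rw [norm_prod]
      exact Finset.prod_le_one (fun _ _ => norm_nonneg _) fun i _ => hk1 S i _
  have key : ∀ S : Finset (Fin n), ∀ s, f s = ∫ ξ, h ξ * ∏ i, k S i (2 * Real.pi * ξ i * s i) := by
    intro S
    induction S using Finset.induction_on with
    | empty => simpa [k] using hf
    | insert j S hj ih =>
      intro s
      have h1 : f s = (f s + (-1) ^ d j * f (coordNeg j s)) / 2 := by
        rw [hpar, ← mul_assoc, ← mul_pow]
        norm_num
      rw [h1, ih s, ih (coordNeg j s), ← integral_const_mul, ← integral_add (hI _ _)
        ((hI _ _).const_mul _), ← integral_div]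
      refine integral_congr_ae (Filter.Eventually.of_forall fun ξ => ?_)
      have h2 : ∀ T (s : EuclideanSpace ℝ (Fin n)), ∏ i, k T i (2 * Real.pi * ξ i * s i) =
          k T j (2 * Real.pi * ξ j * s j) *
            ∏ i ∈ Finset.univ.erase j, k T i (2 * Real.pi * ξ i * s i) := fun T s =>
        (Finset.mul_prod_erase _ _ (Finset.mem_univ j)).symm
      have h3 : ∏ i ∈ Finset.univ.erase j, k S i (2 * Real.pi * ξ i * coordNeg j s i) =
          ∏ i ∈ Finset.univ.erase j, k S i (2 * Real.pi * ξ i * s i) :=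
        Finset.prod_congr rfl fun i hi => by rw [coordNeg_of_ne (Finset.ne_of_mem_erase hi)]
      have h4 : ∏ i ∈ Finset.univ.erase j, k (insert j S) i (2 * Real.pi * ξ i * s i) =
          ∏ i ∈ Finset.univ.erase j, k S i (2 * Real.pi * ξ i * s i) :=
        Finset.prod_congr rfl fun i hi => by
          simp [k, Finset.mem_insert, Finset.ne_of_mem_erase hi]
      simp only [h2, h3, h4, coordNeg_self]
      simp only [k, hj, if_false, Finset.mem_insert_self, if_true, parityExp]
      rw [mul_neg, Complex.ofReal_neg]
      ring
  simpa [k] using key Finset.univ s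

/-- The compactly supported case of `exists_contDiff_comp_coordSq`. -/
theorem exists_contDiff_comp_coordSq_of_hasCompactSupport {n : ℕ} {d : Fin n → ℕ}
    (hd : ∀ i, d i < 2) {f : EuclideanSpace ℝ (Fin n) → ℝ} (hf : ContDiff ℝ ∞ f)
    (hsupp : HasCompactSupport f) (hpar : ∀ j s, f (coordNeg j s) = (-1) ^ d j * f s) :
    ∃ g : EuclideanSpace ℝ (Fin n) → ℝ, ContDiff ℝ ∞ g ∧
      ∀ s, f s = (∏ i, s i ^ d i) * g (coordSq s) := by
  have hfC : ContDiff ℝ ∞ fun s => (f s : ℂ) := Complex.ofRealCLM.contDiff.comp hf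
  have hsC : HasCompactSupport fun s => (f s : ℂ) :=
    hsupp.comp_left (g := fun x : ℝ => (x : ℂ)) Complex.ofReal_zero
  let F := hsC.toSchwartzMap hfC
  have hinv : ∀ s, (f s : ℂ) = ∫ ξ, (𝓕 F) ξ *
      ∏ i, Complex.exp (((2 * Real.pi * ξ i * s i : ℝ) : ℂ) * Complex.I) := by
    intro s
    have h1 : (f s : ℂ) = (𝓕⁻ (𝓕 F)) s := by
      rw [FourierTransform.fourierInv_fourier_eq]
      rfl
    rw [h1, SchwartzMap.fourierInv_coe, Real.fourierInv_eq']
    refine integral_congr_ae (Filter.Eventually.of_forall fun ξ => ?_)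
    simp only [smul_eq_mul]
    rw [mul_comm, ← Complex.exp_sum]
    congr 2
    rw [← Finset.sum_mul, ← Complex.ofReal_sum]
    congr 2
    simp only [PiLp.inner_apply, RCLike.inner_apply, conj_trivial, Finset.mul_sum]
    exact Finset.sum_congr rfl fun i _ => by ring
  have hsym := fourier_symmetrize (𝓕 F).integrable hinv (d := d)
    (fun j s => by rw [hpar]; push_cast; ring)
  choose χ hχ hχe using fun i => exists_temperate_parityExp (hd i)
  let c : ℂ := ∏ i, Complex.I ^ d i
  let h : EuclideanSpace ℝ (Fin n) → ℝ := fun ξ => (c * (𝓕 F) ξ).re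
  let K : EuclideanSpace ℝ (Fin n) × EuclideanSpace ℝ (Fin n) → ℝ := fun p =>
    ∏ i, (2 * Real.pi * p.2 i) ^ d i * χ i ((2 * Real.pi * p.2 i) ^ 2 * p.1 i)
  have hK : K.HasTemperateGrowth := by
    have hfst : ∀ i, Function.HasTemperateGrowth
        fun p : EuclideanSpace ℝ (Fin n) × EuclideanSpace ℝ (Fin n) => p.1 i := fun i =>
      let L : EuclideanSpace ℝ (Fin n) × EuclideanSpace ℝ (Fin n) →L[ℝ] ℝ :=
        (EuclideanSpace.proj i).comp (ContinuousLinearMap.fst ℝ _ _)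
      L.hasTemperateGrowth
    have hsnd : ∀ i, Function.HasTemperateGrowth
        fun p : EuclideanSpace ℝ (Fin n) × EuclideanSpace ℝ (Fin n) => p.2 i := fun i =>
      let L : EuclideanSpace ℝ (Fin n) × EuclideanSpace ℝ (Fin n) →L[ℝ] ℝ :=
        (EuclideanSpace.proj i).comp (ContinuousLinearMap.snd ℝ _ _)
      L.hasTemperateGrowth
    have hprod : ∀ S : Finset (Fin n), Function.HasTemperateGrowth
        fun p : EuclideanSpace ℝ (Fin n) × EuclideanSpace ℝ (Fin n) => ∏ i ∈ S,
          ((2 * Real.pi * p.2 i) ^ d i * χ i ((2 * Real.pi * p.2 i) ^ 2 * p.1 i)) := by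
      intro S
      classical
      induction S using Finset.induction_on with
      | empty => simp
      | insert j S hj ih =>
        simp only [Finset.prod_insert hj]
        have h1 : Function.HasTemperateGrowth
            fun p : EuclideanSpace ℝ (Fin n) × EuclideanSpace ℝ (Fin n) =>
              2 * Real.pi * p.2 j := (Function.HasTemperateGrowth.const _).mul (hsnd j)
        exact ((h1.pow _).mul ((hχ j).comp ((h1.pow 2).mul (hfst j)))).mul ih
    exact hprod _
  have hdec : ∀ k : ℕ, Integrable fun ξ => (1 + ‖ξ‖) ^ k * ‖h ξ‖ := by
    intro k
    have hh : Continuous h := Complex.continuous_re.comp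
      (continuous_const.mul (𝓕 F).continuous)
    have h1 := (((𝓕 F).integrable_pow_mul volume k).add
      ((𝓕 F).integrable_pow_mul volume 0)).const_mul (2 ^ k * ‖c‖)
    refine h1.mono' (by fun_prop) (Filter.Eventually.of_forall fun ξ => ?_)
    have h2 : ‖h ξ‖ ≤ ‖c‖ * ‖(𝓕 F) ξ‖ := by
      rw [← norm_mul]
      exact Complex.abs_re_le_norm _
    have h3 : (1 + ‖ξ‖) ^ k ≤ 2 ^ k * (‖ξ‖ ^ k + ‖ξ‖ ^ 0) := by
      rcases le_total ‖ξ‖ 1 with h | h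
      · calc (1 + ‖ξ‖) ^ k ≤ 2 ^ k := by gcongr; linarith
          _ ≤ _ := le_mul_of_one_le_right (by positivity) (by simp)
      · calc (1 + ‖ξ‖) ^ k ≤ (2 * ‖ξ‖) ^ k := by gcongr; linarith
          _ = 2 ^ k * ‖ξ‖ ^ k := mul_pow _ _ _
          _ ≤ _ := by gcongr; simp
    rw [Real.norm_of_nonneg (by positivity)]
    calc (1 + ‖ξ‖) ^ k * ‖h ξ‖ ≤ (2 ^ k * (‖ξ‖ ^ k + ‖ξ‖ ^ 0)) * (‖c‖ * ‖(𝓕 F) ξ‖) := by gcongr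
      _ = _ := by simp only [Pi.add_apply]; ring
  have hh : Continuous h := Complex.continuous_re.comp (continuous_const.mul (𝓕 F).continuous)
  refine ⟨fun x => ∫ ξ, h ξ • K (x, ξ), contDiff_integral_temperate hh hdec hK, fun s => ?_⟩
  rw [← integral_const_mul]
  have hre : f s = (∫ ξ, (𝓕 F) ξ * ∏ i, parityExp (d i) (2 * Real.pi * ξ i * s i)).re := by
    rw [← hsym, Complex.ofReal_re]
  have hint : Integrable fun ξ => (𝓕 F) ξ * ∏ i, parityExp (d i) (2 * Real.pi * ξ i * s i) := by
    refine (𝓕 F).integrable.mul_bdd (c := 1) ?_ (Filter.Eventually.of_forall fun ξ => ?_)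
    · exact (continuous_finsetProd _ fun i _ => (continuous_parityExp (d i)).comp
        (by fun_prop)).aestronglyMeasurable
    · rw [norm_prod]
      exact Finset.prod_le_one (fun _ _ => norm_nonneg _) fun i _ => norm_parityExp_le _ _
  rw [hre]
  refine (Complex.reCLM.integral_comp_comm hint).symm.trans
    (integral_congr_ae (Filter.Eventually.of_forall fun ξ => ?_))
  simp only [Complex.reCLM_apply, hχe, Finset.prod_mul_distrib, ← Complex.ofReal_prod, smul_eq_mul]
  have hhξ : h ξ = ((𝓕 F) ξ * ∏ i, Complex.I ^ d i).re := by simp only [h, c, mul_comm]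
  rw [← mul_assoc, Complex.re_mul_ofReal, hhξ]
  simp only [K, coordSq_apply, Finset.prod_mul_distrib, mul_pow]
  ring

open scoped Manifold in
/-- A parametrised form of Whitney's theorem on even functions: a smooth function on `ℝⁿ` which is
even in the coordinates with `d i = 0` and odd in those with `d i = 1` is the product of the odd
coordinates by a smooth function of the squares. The second factor is smooth on all of `ℝⁿ`, not
only on the closed orthant, so no separate extension theorem is needed. -/
theorem exists_contDiff_comp_coordSq {n : ℕ} {d : Fin n → ℕ} (hd : ∀ i, d i < 2)
    {f : EuclideanSpace ℝ (Fin n) → ℝ} (hf : ContDiff ℝ ∞ f)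
    (hpar : ∀ j s, f (coordNeg j s) = (-1) ^ d j * f s) :
    ∃ g : EuclideanSpace ℝ (Fin n) → ℝ, ContDiff ℝ ∞ g ∧
      ∀ s, f s = (∏ i, s i ^ d i) * g (coordSq s) := by
  let t : EuclideanSpace ℝ (Fin n) → Set ℝ := fun x =>
    {z | ∀ s, coordSq s = x → f s = (∏ i, s i ^ d i) * z}
  have ht : ∀ x, Convex ℝ (t x) := by
    intro x z hz w hw a b _ _ hab s hs
    rw [smul_eq_mul, smul_eq_mul, mul_add, mul_left_comm, ← hz s hs, mul_left_comm, ← hw s hs,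
      ← add_mul, hab, one_mul]
  obtain ⟨g, hg⟩ := exists_contMDiffMap_forall_mem_convex_of_local
    (𝓘(ℝ, EuclideanSpace ℝ (Fin n))) (n := ⊤) ht (fun x => by
      let χ : ContDiffBump x := ⟨1, 2, by norm_num, by norm_num⟩
      have hc : HasCompactSupport fun s => χ (coordSq s) * f s := by
        refine HasCompactSupport.intro
          (isCompact_closedBall (0 : EuclideanSpace ℝ (Fin n)) (√(n * (‖x‖ + 2)))) fun s hs => ?_
        have h0 : χ (coordSq s) = 0 := by
          by_contra hne
          have h1 : coordSq s ∈ Metric.ball x 2 := χ.support_eq ▸ hne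
          apply hs
          rw [mem_closedBall_zero_iff, EuclideanSpace.norm_eq]
          apply Real.sqrt_le_sqrt
          have h2 : ∀ i, ‖s i‖ ^ 2 ≤ ‖x‖ + 2 := by
            intro i
            have h3 := PiLp.norm_apply_le (coordSq s) i
            rw [coordSq_apply, norm_pow] at h3
            have h4 := norm_le_norm_add_norm_sub' (coordSq s) x
            rw [mem_ball_iff_norm] at h1
            linarith
          refine (Finset.sum_le_card_nsmul _ _ _ fun i _ => h2 i).trans_eq ?_
          simp [mul_add]
        rw [h0, zero_mul]
      obtain ⟨g, hg, hgs⟩ := exists_contDiff_comp_coordSq_of_hasCompactSupport hd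
        ((χ.contDiff.comp contDiff_coordSq).mul hf) hc
        (fun j s => by simp only [Function.comp_apply, coordSq_coordNeg, hpar]; ring)
      refine ⟨Metric.ball x 1, Metric.ball_mem_nhds x one_pos, g, hg.contMDiff.contMDiffOn, ?_⟩
      rintro y hy s rfl
      rw [← hgs s]
      simp only [Function.comp_apply]
      rw [χ.one_of_mem_closedBall (Metric.ball_subset_closedBall hy), one_mul])
  exact ⟨g, g.contMDiff.contDiff, fun s => hg _ s rfl⟩

end Parity

/-! ### Plots of the quadrant -/

section Plots

open Filter Topology

/-- The map into the quadrant with given nonnegative coordinates. -/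
def quadrantMap {n : ℕ} (p : Fin 2 → EuclideanSpace ℝ (Fin n) → ℝ) (hp : ∀ i t, 0 ≤ p i t)
    (t : EuclideanSpace ℝ (Fin n)) : quadrant :=
  ⟨WithLp.toLp 2 fun i => p i t, hp 0 t, hp 1 t⟩

theorem isPlot_quadrantMap {n : ℕ} {p : Fin 2 → EuclideanSpace ℝ (Fin n) → ℝ}
    {hp : ∀ i t, 0 ≤ p i t} (h : ∀ i, ContDiff ℝ ∞ (p i)) : IsPlot (quadrantMap p hp) := by
  have h1 : ContDiff ℝ ∞ fun t => (quadrantMap p hp t : EuclideanSpace ℝ (Fin 2)) :=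
    contDiff_euclidean.2 fun i => h i
  have h2 : IsPlot fun t => (quadrantMap p hp t : EuclideanSpace ℝ (Fin 2)) :=
    isPlot_iff_contDiff.2 h1
  exact h2

theorem quadrantCoord_nonneg (i : Fin 2) (p : quadrant) : 0 ≤ (quadrantCoord i p : ℝ) :=
  (quadrantCoord i p).2

theorem contDiff_quadrantCoord {n : ℕ} {P : EuclideanSpace ℝ (Fin n) → quadrant} (hP : IsPlot P)
    (i : Fin 2) : ContDiff ℝ ∞ fun t => (quadrantCoord i (P t) : ℝ) := by
  have h1 : ContDiff ℝ ∞ fun t => (P t : EuclideanSpace ℝ (Fin 2)) := isPlot_iff_contDiff.1 hP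
  exact contDiff_euclidean.1 h1 i

theorem fderiv_plot_apply {n : ℕ} {P : EuclideanSpace ℝ (Fin n) → quadrant} (hP : IsPlot P)
    (i : Fin 2) (r v : EuclideanSpace ℝ (Fin n)) :
    fderiv ℝ (fun t => (P t : EuclideanSpace ℝ (Fin 2))) r v i = coordDiff i P r v := by
  have h1 : ContDiff ℝ ∞ fun t => (P t : EuclideanSpace ℝ (Fin 2)) := isPlot_iff_contDiff.1 hP
  have h2 := (h1.differentiable (by simp) r).hasFDerivAt
  have h3 := (EuclideanSpace.proj i : EuclideanSpace ℝ (Fin 2) →L[ℝ] ℝ).hasFDerivAt.comp r h2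
  exact (congrArg (fun L => L v) h3.fderiv).symm

/-- The folding plot `(s, t) ↦ (s², t²)` of the quadrant. -/
def foldPlot : EuclideanSpace ℝ (Fin 2) → quadrant :=
  quadrantMap (fun i s => s i ^ 2) fun i s => sq_nonneg (s i)

theorem isPlot_foldPlot : IsPlot foldPlot := isPlot_quadrantMap fun i => by fun_prop

theorem coordDiff_foldPlot (i : Fin 2) (s v : EuclideanSpace ℝ (Fin 2)) :
    coordDiff i foldPlot s v = 2 * s i * v i := by
  have h1 := ((EuclideanSpace.proj i : EuclideanSpace ℝ (Fin 2) →L[ℝ] ℝ).hasFDerivAt (x := s)).pow 2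
  have h2 := congrArg (fun L => L v) h1.fderiv
  refine Eq.trans h2 ?_
  simp

/-- The plot `(u, v, t) ↦ (u² + v², t²)` of the quadrant, for `i = 0`, and the one with exchanged
coordinates for `i = 1`. -/
def conePlot (i : Fin 2) : EuclideanSpace ℝ (Fin 3) → quadrant :=
  quadrantMap (fun k u => if k = i then u 0 ^ 2 + u 1 ^ 2 else u 2 ^ 2) fun k u => by
    split_ifs <;> positivity

theorem isPlot_conePlot (i : Fin 2) : IsPlot (conePlot i) :=
  isPlot_quadrantMap fun k => by
    by_cases h : k = i
    · simp only [h, if_true]; fun_prop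
    · simp only [h, if_false]; fun_prop

theorem coordDiff_conePlot (i k : Fin 2) (u v : EuclideanSpace ℝ (Fin 3)) :
    coordDiff k (conePlot i) u v =
      if k = i then 2 * u 0 * v 0 + 2 * u 1 * v 1 else 2 * u 2 * v 2 := by
  have h1 : ∀ j : Fin 3, HasFDerivAt (fun u : EuclideanSpace ℝ (Fin 3) => u j ^ 2) _ u := fun j =>
    ((EuclideanSpace.proj j : EuclideanSpace ℝ (Fin 3) →L[ℝ] ℝ).hasFDerivAt (x := u)).pow 2
  by_cases h : k = i
  · have h2 : (fun t => (quadrantCoord k (conePlot i t) : ℝ)) = fun u => u 0 ^ 2 + u 1 ^ 2 :=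
      funext fun t => if_pos h
    rw [coordDiff, h2, ((h1 0).fun_add (h1 1)).fderiv, if_pos h]
    simp
  · have h2 : (fun t => (quadrantCoord k (conePlot i t) : ℝ)) = fun u => u 2 ^ 2 :=
      funext fun t => if_neg h
    rw [coordDiff, h2, (h1 2).fderiv, if_neg h]
    simp

end Plots

/-! ### Locality of tensors -/

section Locality

open Filter Topology

theorem DiffSymTensor.val_congr {X : Type*} [DiffeologicalSpace X] (τ : DiffSymTensor X) {n : ℕ}
    {P Q : EuclideanSpace ℝ (Fin n) → X} (h : P = Q) (hP : IsPlot P) (hQ : IsPlot Q) :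
    τ.val P hP = τ.val Q hQ := by
  subst h
  rfl

/-- Every point has arbitrarily small neighbourhoods into which the whole space is mapped by a
smooth map that is the identity near the point. -/
theorem exists_contDiff_eventually_id {n : ℕ} (r : EuclideanSpace ℝ (Fin n))
    {U : Set (EuclideanSpace ℝ (Fin n))} (hU : U ∈ 𝓝 r) :
    ∃ F : EuclideanSpace ℝ (Fin n) → EuclideanSpace ℝ (Fin n), ContDiff ℝ ∞ F ∧
      (∀ᶠ t in 𝓝 r, F t = t) ∧ ∀ t, F t ∈ U := by
  obtain ⟨ε, hε, hb⟩ := Metric.mem_nhds_iff.1 hU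
  let χ : ContDiffBump r := ⟨ε / 2, ε, by positivity, by linarith⟩
  refine ⟨fun t => r + χ t • (t - r), contDiff_const.add
    (χ.contDiff.smul (contDiff_id.sub contDiff_const)), ?_, fun t => hb ?_⟩
  · filter_upwards [χ.eventuallyEq_one] with t ht
    simp [ht]
  · rw [mem_ball_iff_norm, add_sub_cancel_left, norm_smul]
    by_cases h : χ t = 0
    · simpa [h] using hε
    · have h1 : t ∈ Metric.ball r ε := χ.support_eq ▸ h
      rw [mem_ball_iff_norm] at h1
      rw [Real.norm_of_nonneg χ.nonneg]
      exact (mul_le_of_le_one_left (norm_nonneg _) χ.le_one).trans_lt h1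

/-- The pullback rule under a reparametrization which is only defined and smooth near a point. -/
theorem DiffSymTensor.val_eq_of_eventuallyEq {X : Type*} [DiffeologicalSpace X]
    (τ : DiffSymTensor X) {m n : ℕ} {P : EuclideanSpace ℝ (Fin n) → X}
    {Q : EuclideanSpace ℝ (Fin m) → X} (hP : IsPlot P) (hQ : IsPlot Q)
    {G : EuclideanSpace ℝ (Fin n) → EuclideanSpace ℝ (Fin m)} {r : EuclideanSpace ℝ (Fin n)}
    (hG : ∀ᶠ t in 𝓝 r, ContDiffAt ℝ ∞ G t) (h : ∀ᶠ t in 𝓝 r, P t = Q (G t))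
    (v w : EuclideanSpace ℝ (Fin n)) :
    τ.val P hP r v w = τ.val Q hQ (G r) (fderiv ℝ G r v) (fderiv ℝ G r w) := by
  obtain ⟨F, hF, hFr, hFU⟩ := exists_contDiff_eventually_id r (hG.and h)
  have hF0 : F r = r := hFr.self_of_nhds
  have hF1 : fderiv ℝ F r = ContinuousLinearMap.id ℝ _ := by
    have h1 : F =ᶠ[𝓝 r] id := hFr
    rw [h1.fderiv_eq, fderiv_id]
  have hGF : ContDiff ℝ ∞ (G ∘ F) := contDiff_iff_contDiffAt.2 fun t =>
    (hFU t).1.comp t hF.contDiffAt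
  have h1 := τ.pullback P hP F hF r v w
  have h2 := τ.pullback Q hQ (G ∘ F) hGF r v w
  have h3 : P ∘ F = Q ∘ (G ∘ F) := funext fun t => (hFU t).2
  have h4 : fderiv ℝ (G ∘ F) r = fderiv ℝ G r := by
    have h5 : G ∘ F =ᶠ[𝓝 r] G := hFr.mono fun t ht => congrArg G ht
    exact h5.fderiv_eq
  rw [τ.val_congr h3 _ (isPlot_reparam hQ hGF), h2, h4] at h1
  simpa [hF0, hF1] using h1.symm

/-- A tensor on the quadrant is determined by its values at the points sent to the interior: every
plot `P` extends to the plot `P(t) + (z², z²)`, which takes interior values for `z ≠ 0`. -/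
theorem DiffSymTensor.eq_of_eq_interior {τ τ' : DiffSymTensor quadrant}
    (h : ∀ {n : ℕ} (P : EuclideanSpace ℝ (Fin n) → quadrant) (hP : IsPlot P)
      (r v w : EuclideanSpace ℝ (Fin n)), (∀ i, 0 < (quadrantCoord i (P r) : ℝ)) →
      τ.val P hP r v w = τ'.val P hP r v w) : τ = τ' := by
  apply DiffSymTensor.ext
  funext n P hP r
  ext v w
  let ι : EuclideanSpace ℝ (Fin n) →L[ℝ] EuclideanSpace ℝ (Fin (n + 1)) :=
    LinearMap.toContinuousLinearMap
      { toFun := fun x => WithLp.toLp 2 (Fin.cons 0 x : Fin (n + 1) → ℝ)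
        map_add' := fun x y => by
          ext i
          refine Fin.cases ?_ (fun j => ?_) i <;> simp
        map_smul' := fun c x => by
          ext i
          refine Fin.cases ?_ (fun j => ?_) i <;> simp }
  let tail : EuclideanSpace ℝ (Fin (n + 1)) → EuclideanSpace ℝ (Fin n) :=
    fun t => WithLp.toLp 2 fun i => t i.succ
  have htail : ContDiff ℝ ∞ tail := contDiff_euclidean.2 fun i => by
    simp only [tail]
    fun_prop
  let Q : EuclideanSpace ℝ (Fin (n + 1)) → quadrant :=
    quadrantMap (fun i t => quadrantCoord i (P (tail t)) + t 0 ^ 2)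
      fun i t => add_nonneg (quadrantCoord_nonneg i _) (sq_nonneg _)
  have hQ : IsPlot Q := isPlot_quadrantMap fun i =>
    ((contDiff_quadrantCoord hP i).comp htail).add (by fun_prop)
  have hPQ : P = Q ∘ ι := by
    funext t
    apply Subtype.ext
    ext i
    have h1 : tail (ι t) = t := by
      ext i
      simp [tail, ι]
    have h2 : (ι t) 0 = 0 := by simp [ι]
    change (P t : EuclideanSpace ℝ (Fin 2)) i =
      (P (tail (ι t)) : EuclideanSpace ℝ (Fin 2)) i + (ι t) 0 ^ 2
    rw [h1, h2]
    simp
  have hval : ∀ σ : DiffSymTensor quadrant, σ.val P hP r v w = σ.val Q hQ (ι r) (ι v) (ι w) := by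
    intro σ
    have h1 := σ.pullback Q hQ ι ι.contDiff r v w
    rw [ι.fderiv] at h1
    rw [← h1, σ.val_congr hPQ hP (isPlot_reparam hQ ι.contDiff)]
  have hdense : Dense {t : EuclideanSpace ℝ (Fin (n + 1)) | t 0 ≠ 0} := by
    have h1 : IsOpenMap (EuclideanSpace.proj 0 : EuclideanSpace ℝ (Fin (n + 1)) →L[ℝ] ℝ) :=
      ContinuousLinearMap.isOpenMap _ fun c => ⟨EuclideanSpace.single 0 c, by simp⟩
    exact (dense_compl_singleton (0 : ℝ)).preimage h1
  have heq : (fun t => τ.val Q hQ t (ι v) (ι w)) = fun t => τ'.val Q hQ t (ι v) (ι w) := by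
    refine Continuous.ext_on hdense ?_ ?_ fun t ht => h Q hQ t _ _ fun i => ?_
    · exact ((τ.smooth Q hQ).continuous.clm_apply continuous_const).clm_apply continuous_const
    · exact ((τ'.smooth Q hQ).continuous.clm_apply continuous_const).clm_apply continuous_const
    · exact add_pos_of_nonneg_of_pos (quadrantCoord_nonneg i _) (sq_pos_of_ne_zero ht)
  rw [hval τ, hval τ']
  exact congrFun heq (ι r)

end Locality

/-! ### Coefficients of a tensor on the interior -/

section Coefficients

open Filter Topology

/-- The coordinatewise square root, the inverse of the folding plot on the interior. -/
noncomputable def coordSqrt (p : EuclideanSpace ℝ (Fin 2)) : EuclideanSpace ℝ (Fin 2) :=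
  WithLp.toLp 2 fun i => √(p i)

/-- The coefficient `mᵢⱼ` of `τ = ∑ mᵢⱼ dxᵢ ⊗ dxⱼ` at an interior point `p` of the quadrant, read
off from the folding plot `xᵢ = sᵢ²`, for which `dxᵢ = 2 sᵢ dsᵢ`. It has no meaning elsewhere. -/
noncomputable def interiorCoeff (τ : DiffSymTensor quadrant) (i j : Fin 2)
    (p : EuclideanSpace ℝ (Fin 2)) : ℝ :=
  τ.val foldPlot isPlot_foldPlot (coordSqrt p) (EuclideanSpace.single i 1)
    (EuclideanSpace.single j 1) / (4 * √(p i) * √(p j))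

theorem interiorCoeff_comm (τ : DiffSymTensor quadrant) (i j : Fin 2)
    (p : EuclideanSpace ℝ (Fin 2)) : interiorCoeff τ i j p = interiorCoeff τ j i p := by
  unfold interiorCoeff
  rw [τ.symm]
  ring

/-- On the interior, every plot lifts through the folding plot, locally. -/
theorem val_eq_sum_interiorCoeff (τ : DiffSymTensor quadrant) {n : ℕ}
    {P : EuclideanSpace ℝ (Fin n) → quadrant} (hP : IsPlot P) {r : EuclideanSpace ℝ (Fin n)}
    (hr : ∀ i, 0 < (quadrantCoord i (P r) : ℝ)) (v w : EuclideanSpace ℝ (Fin n)) :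
    τ.val P hP r v w = ∑ i, ∑ j, interiorCoeff τ i j (P r) *
      (coordDiff i P r v * coordDiff j P r w) := by
  have hpos : ∀ᶠ t in 𝓝 r, ∀ i, 0 < (quadrantCoord i (P t) : ℝ) :=
    eventually_all.2 fun i =>
      (contDiff_quadrantCoord hP i).continuous.continuousAt.eventually (lt_mem_nhds (hr i))
  have hd : ∀ i, HasFDerivAt (fun t => √(quadrantCoord i (P t) : ℝ)) _ r := fun i =>
    ((contDiff_quadrantCoord hP i).differentiable (by simp) r).hasFDerivAt.sqrt (hr i).ne'
  let G : EuclideanSpace ℝ (Fin n) → EuclideanSpace ℝ (Fin 2) := fun t => coordSqrt (P t)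
  have hG : ∀ᶠ t in 𝓝 r, ContDiffAt ℝ ∞ G t := hpos.mono fun t ht =>
    contDiffAt_euclidean.2 fun i => (contDiff_quadrantCoord hP i).contDiffAt.sqrt (ht i).ne'
  have hGi : ∀ u i, fderiv ℝ G r u i =
      coordDiff i P r u / (2 * √(quadrantCoord i (P r) : ℝ)) := by
    intro u i
    have h2 := (hG.self_of_nhds.differentiableAt (by simp)).hasFDerivAt
    have h3 := (EuclideanSpace.proj i : EuclideanSpace ℝ (Fin 2) →L[ℝ] ℝ).hasFDerivAt.comp r h2
    have h4 := congrArg (fun L => L u) (h3.unique (hd i))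
    refine Eq.trans h4 ?_
    simp only [smul_apply, smul_eq_mul, coordDiff]
    ring
  have hb : ∀ x : EuclideanSpace ℝ (Fin 2), x = ∑ i, x i • EuclideanSpace.single i (1 : ℝ) := by
    intro x
    ext k
    fin_cases k <;> simp
  rw [τ.val_eq_of_eventuallyEq hP isPlot_foldPlot hG (hpos.mono fun t ht => Subtype.ext (by
    ext i
    exact (Real.sq_sqrt (ht i).le).symm)), hb (fderiv ℝ G r v), hb (fderiv ℝ G r w)]
  simp only [map_sum, map_smul, sum_apply, smul_apply, hGi,
    smul_eq_mul, Finset.mul_sum]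
  rw [Finset.sum_comm]
  refine Finset.sum_congr rfl fun i _ => Finset.sum_congr rfl fun j _ => ?_
  have hi : √(quadrantCoord i (P r) : ℝ) ≠ 0 := (Real.sqrt_pos.2 (hr i)).ne'
  have hj : √(quadrantCoord j (P r) : ℝ) ≠ 0 := (Real.sqrt_pos.2 (hr j)).ne'
  change _ = τ.val foldPlot isPlot_foldPlot (G r) (EuclideanSpace.single i 1)
    (EuclideanSpace.single j 1) / (4 * √(quadrantCoord i (P r) : ℝ) *
      √(quadrantCoord j (P r) : ℝ)) * _
  field_simp
  ring

theorem fderiv_coordNeg {n : ℕ} (j : Fin n) (s v : EuclideanSpace ℝ (Fin n)) :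
    fderiv ℝ (coordNeg j) s v = coordNeg j v := by
  let L : EuclideanSpace ℝ (Fin n) →L[ℝ] EuclideanSpace ℝ (Fin n) :=
    LinearMap.toContinuousLinearMap
      { toFun := coordNeg j
        map_add' := fun x y => by
          ext i
          rcases eq_or_ne i j with rfl | h
          · simp only [coordNeg_self, PiLp.add_apply]; ring
          · simp only [coordNeg_of_ne h, PiLp.add_apply]
        map_smul' := fun c x => by
          ext i
          rcases eq_or_ne i j with rfl | h
          · simp [coordNeg_self]
          · simp [coordNeg_of_ne h] }
  exact congrArg (fun M => M v) (L.fderiv (x := s))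

theorem contDiff_coordNeg {n : ℕ} (j : Fin n) : ContDiff ℝ ∞ (coordNeg j) := by
  rw [contDiff_euclidean]
  intro i
  rcases eq_or_ne i j with rfl | h
  · simp only [coordNeg_self]; fun_prop
  · simp only [coordNeg_of_ne h]; fun_prop

theorem coordNeg_single {n : ℕ} (i j : Fin n) :
    coordNeg j (EuclideanSpace.single i (1 : ℝ)) =
      ((-1 : ℝ) ^ (if j = i then 1 else 0)) • EuclideanSpace.single i (1 : ℝ) := by
  ext k
  rcases eq_or_ne k j with rfl | h
  · rw [coordNeg_self]
    by_cases h' : k = i <;> simp [h']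
  · rw [coordNeg_of_ne h]
    by_cases h' : j = i
    · subst h'; simp [h]
    · simp [h']

/-- On a plot which is even in every coordinate, the coefficient of `dsᵢ dsₖ`, `i ≠ k`, is odd in
`sᵢ` and in `sₖ` and even in the other coordinates. -/
theorem exists_contDiff_val_single (τ : DiffSymTensor quadrant) {n : ℕ}
    {Q : EuclideanSpace ℝ (Fin n) → quadrant} (hQ : IsPlot Q)
    (hsymm : ∀ j s, Q (coordNeg j s) = Q s) {i k : Fin n} (hik : i ≠ k) :
    ∃ g : EuclideanSpace ℝ (Fin n) → ℝ, ContDiff ℝ ∞ g ∧ ∀ s,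
      τ.val Q hQ s (EuclideanSpace.single i 1) (EuclideanSpace.single k 1) =
        s i * s k * g (coordSq s) := by
  let d : Fin n → ℕ := fun j => (if j = i then 1 else 0) + if j = k then 1 else 0
  have hd : ∀ j, d j < 2 := by
    intro j
    simp only [d]
    split_ifs with h1 h2
    · exact absurd (h1.symm.trans h2) hik
    all_goals norm_num
  obtain ⟨g, hg, h⟩ := exists_contDiff_comp_coordSq hd
    (f := fun s => τ.val Q hQ s (EuclideanSpace.single i 1) (EuclideanSpace.single k 1))
    (((τ.smooth Q hQ).clm_apply contDiff_const).clm_apply contDiff_const) (fun j s => by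
      have h1 := τ.pullback Q hQ (coordNeg j) (contDiff_coordNeg j) (coordNeg j s)
        (EuclideanSpace.single i 1) (EuclideanSpace.single k 1)
      have h2 : coordNeg j (coordNeg j s) = s := by
        ext l
        rcases eq_or_ne l j with rfl | h
        · rw [coordNeg_self, coordNeg_self, neg_neg]
        · rw [coordNeg_of_ne h, coordNeg_of_ne h]
      rw [τ.val_congr (funext fun s => hsymm j s : Q ∘ coordNeg j = Q) _ hQ, fderiv_coordNeg,
        fderiv_coordNeg, coordNeg_single, coordNeg_single, h2] at h1
      rw [h1]
      simp only [map_smul, smul_apply, smul_eq_mul, d, pow_add]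
      ring)
  refine ⟨g, hg, fun s => ?_⟩
  rw [h s]
  congr 1
  simp only [d, pow_add, Finset.prod_mul_distrib, pow_ite, pow_one, pow_zero, Finset.prod_ite_eq',
    Finset.mem_univ, if_true]

theorem exists_contDiff_eq_interiorCoeff_zero_one (τ : DiffSymTensor quadrant) :
    ∃ g : EuclideanSpace ℝ (Fin 2) → ℝ, ContDiff ℝ ∞ g ∧
      ∀ p : EuclideanSpace ℝ (Fin 2), (∀ i, 0 < p i) → interiorCoeff τ 0 1 p = g p := by
  obtain ⟨g, hg, h⟩ := exists_contDiff_val_single τ isPlot_foldPlot (i := 0) (k := 1)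
    (fun j s => Subtype.ext (coordSq_coordNeg j s)) (by decide)
  refine ⟨fun p => g p / 4, hg.div_const 4, fun p hp => ?_⟩
  have h0 : √(p 0) ≠ 0 := (Real.sqrt_pos.2 (hp 0)).ne'
  have h1 : √(p 1) ≠ 0 := (Real.sqrt_pos.2 (hp 1)).ne'
  have h2 : coordSq (coordSqrt p) = p := by
    ext i
    exact Real.sq_sqrt (hp i).le
  rw [interiorCoeff, h, h2]
  change √(p 0) * √(p 1) * g p / _ = _
  field_simp

/-- The axial coefficients have no singularity at the boundary. On the plot `x = u² + v²` the form
`m dx²` has mixed coefficient `4 u v m`. This being odd in `u` and in `v`, it is `u v` times a smooth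
function of the squares, so `m` itself is smooth up to the boundary. -/
theorem exists_contDiff_eq_interiorCoeff_self (τ : DiffSymTensor quadrant) (i : Fin 2) :
    ∃ g : EuclideanSpace ℝ (Fin 2) → ℝ, ContDiff ℝ ∞ g ∧
      ∀ p : EuclideanSpace ℝ (Fin 2), (∀ i, 0 < p i) → interiorCoeff τ i i p = g p := by
  have hsymm : ∀ j s, conePlot i (coordNeg j s) = conePlot i s := by
    intro j s
    have h : ∀ k, coordNeg j s k ^ 2 = s k ^ 2 := fun k =>
      congrArg (fun x : EuclideanSpace ℝ (Fin 3) => x k) (coordSq_coordNeg j s)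
    apply Subtype.ext
    ext k
    change (if k = i then _ else _) = if k = i then _ else _
    rw [h, h, h]
  obtain ⟨g, hg, h⟩ := exists_contDiff_val_single τ (isPlot_conePlot i) (i := 0) (k := 1) hsymm
    (by decide)
  let T : EuclideanSpace ℝ (Fin 2) → EuclideanSpace ℝ (Fin 3) :=
    fun p => !₂[p i / 2, p i / 2, p (1 - i)]
  have hT : ContDiff ℝ ∞ T := contDiff_euclidean.2 fun k => by
    fin_cases k <;> simp [T] <;> fun_prop
  refine ⟨fun p => g (T p) / 4, (hg.comp hT).div_const 4, fun p hp => ?_⟩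
  let u : EuclideanSpace ℝ (Fin 3) := !₂[√(p i / 2), √(p i / 2), √(p (1 - i))]
  have hpi := hp i
  have hu : coordSq u = T p := by
    ext k
    rw [coordSq_apply]
    fin_cases k
    · exact Real.sq_sqrt (by positivity)
    · exact Real.sq_sqrt (by positivity)
    · exact Real.sq_sqrt (hp _).le
  have hPu : (conePlot i u : EuclideanSpace ℝ (Fin 2)) = p := by
    ext k
    change (if k = i then √(p i / 2) ^ 2 + √(p i / 2) ^ 2 else √(p (1 - i)) ^ 2) = p k
    rw [Real.sq_sqrt (by positivity), Real.sq_sqrt (hp _).le, add_halves]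
    split_ifs with hk
    · rw [hk]
    · have h1k : 1 - i = k := by omega
      rw [h1k]
  have h1 := h u
  have hint : ∀ k, 0 < (quadrantCoord k (conePlot i u) : ℝ) := fun k => by
    change 0 < (conePlot i u : EuclideanSpace ℝ (Fin 2)) k
    rw [hPu]
    exact hp k
  rw [val_eq_sum_interiorCoeff τ _ hint, hPu, hu] at h1
  simp only [coordDiff_conePlot] at h1
  have hs : 0 < √(p i / 2) := Real.sqrt_pos.2 (by positivity)
  have hu0 : u 0 = √(p i / 2) := rfl
  have hu1 : u 1 = √(p i / 2) := rfl
  rw [hu0, hu1] at h1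
  have h2 : 4 * (√(p i / 2) * √(p i / 2)) * interiorCoeff τ i i p =
      √(p i / 2) * √(p i / 2) * g (T p) := by
    rw [← h1]
    fin_cases i <;> simp <;> ring
  have h3 : √(p i / 2) * √(p i / 2) ≠ 0 := by positivity
  have h4 : 4 * interiorCoeff τ i i p = g (T p) := by
    apply mul_left_cancel₀ h3
    linarith
  linarith

end Coefficients

/-! ### Regularity and uniqueness -/

section Regularity

open Filter Topology

/-- The tensor field `∑ gᵢⱼ dxᵢ ⊗ dxⱼ` on `ℝᵏ` with given symmetric smooth coefficients. -/
noncomputable def SmoothSymTensorField.ofCoeff {k : ℕ}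
    (g : Fin k → Fin k → EuclideanSpace ℝ (Fin k) → ℝ) (hg : ∀ i j, ContDiff ℝ ∞ (g i j))
    (hsymm : ∀ i j, g i j = g j i) : SmoothSymTensorField k where
  val p := ∑ i, ∑ j, g i j p • (EuclideanSpace.proj i : EuclideanSpace ℝ (Fin k) →L[ℝ] ℝ).smulRight
    (EuclideanSpace.proj j : EuclideanSpace ℝ (Fin k) →L[ℝ] ℝ)
  smooth := by
    rw [contDiff_clm_apply_iff]
    intro v
    rw [contDiff_clm_apply_iff]
    intro w
    simp only [sum_apply, smul_apply, smul_eq_mul]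
    exact ContDiff.sum fun i _ => ContDiff.sum fun j _ => (hg i j).mul contDiff_const
  symm p v w := by
    simp only [sum_apply, smul_apply,
      ContinuousLinearMap.smulRight_apply, smul_eq_mul]
    rw [Finset.sum_comm]
    refine Finset.sum_congr rfl fun i _ => Finset.sum_congr rfl fun j _ => ?_
    rw [hsymm j i]
    ring

theorem SmoothSymTensorField.ofCoeff_restrict_val {g : Fin 2 → Fin 2 → EuclideanSpace ℝ (Fin 2) → ℝ}
    {hg : ∀ i j, ContDiff ℝ ∞ (g i j)} {hsymm : ∀ i j, g i j = g j i} {n : ℕ}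
    {P : EuclideanSpace ℝ (Fin n) → quadrant} (hP : IsPlot P) (r v w : EuclideanSpace ℝ (Fin n)) :
    ((SmoothSymTensorField.ofCoeff g hg hsymm).restrict quadrant).val P hP r v w =
      ∑ i, ∑ j, g i j (P r) * (coordDiff i P r v * coordDiff j P r w) := by
  simp only [SmoothSymTensorField.restrict, SmoothSymTensorField.ofCoeff,
    ContinuousLinearMap.bilinearComp_apply, sum_apply,
    smul_apply, ContinuousLinearMap.smulRight_apply, smul_eq_mul,
    PiLp.proj_apply, fderiv_plot_apply hP]

/-- Every tensor on the quadrant has smooth coefficients up to the boundary. -/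
theorem exists_eq_ofCoeff (τ : DiffSymTensor quadrant) :
    ∃ (g : Fin 2 → Fin 2 → EuclideanSpace ℝ (Fin 2) → ℝ) (hg : ∀ i j, ContDiff ℝ ∞ (g i j))
      (hsymm : ∀ i j, g i j = g j i),
      τ = (SmoothSymTensorField.ofCoeff g hg hsymm).restrict quadrant := by
  choose a ha hav using exists_contDiff_eq_interiorCoeff_self τ
  obtain ⟨c, hc, hcv⟩ := exists_contDiff_eq_interiorCoeff_zero_one τ
  let g : Fin 2 → Fin 2 → EuclideanSpace ℝ (Fin 2) → ℝ := fun i j => if i = j then a i else c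
  have hg : ∀ i j, ContDiff ℝ ∞ (g i j) := by
    intro i j
    by_cases h : i = j
    · simp only [g, h, if_true]; exact ha j
    · simp only [g, h, if_false]; exact hc
  have hsymm : ∀ i j, g i j = g j i := by
    intro i j
    by_cases h : i = j
    · rw [h]
    · simp only [g, h, Ne.symm h, if_false]
  refine ⟨g, hg, hsymm, DiffSymTensor.eq_of_eq_interior fun P hP r v w hr => ?_⟩
  rw [SmoothSymTensorField.ofCoeff_restrict_val, val_eq_sum_interiorCoeff τ hP hr]
  have hcoeff : ∀ i j, interiorCoeff τ i j (P r) = g i j (P r) := by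
    intro i j
    by_cases h : i = j
    · subst h
      simpa [g] using hav i _ hr
    · have h01 := hcv _ hr
      simp only [g, h, if_false]
      revert h
      fin_cases i <;> fin_cases j <;> intro h
      · exact absurd rfl h
      · exact h01
      · exact (interiorCoeff_comm _ _ _ _).trans h01
      · exact absurd rfl h
  simp only [hcoeff]

theorem isRegularTensor (τ : DiffSymTensor quadrant) : IsRegularTensor τ := by
  obtain ⟨g, hg, hsymm, h⟩ := exists_eq_ofCoeff τ
  exact ⟨_, h⟩

theorem hasRegularMixedTerm (τ : DiffSymTensor quadrant) : HasRegularMixedTerm τ := by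
  obtain ⟨g, hg, hsymm, rfl⟩ := exists_eq_ofCoeff τ
  refine ⟨g 0 1, hg 0 1, fun P hP r v w _ _ hv0 hv1 hw0 hw1 => ?_⟩
  rw [SmoothSymTensorField.ofCoeff_restrict_val]
  simp [hv0, hv1, hw0, hw1]

/-- A regular tensor vanishes on `(∂ᵢ, ∂ᵢ)` along the edge `sᵢ = 0` of the folding plot, because the
differential of the plot vanishes on `∂ᵢ` there. -/
theorem IsRegularTensor.val_foldPlot_eq_zero {τ : DiffSymTensor quadrant} (hτ : IsRegularTensor τ)
    {i : Fin 2} {s : EuclideanSpace ℝ (Fin 2)} (hs : s i = 0) :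
    τ.val foldPlot isPlot_foldPlot s (EuclideanSpace.single i 1) (EuclideanSpace.single i 1) = 0 := by
  obtain ⟨σ, rfl⟩ := hτ
  have h : fderiv ℝ (fun t => (foldPlot t : EuclideanSpace ℝ (Fin 2))) s
      (EuclideanSpace.single i 1) = 0 := by
    ext k
    rw [fderiv_plot_apply isPlot_foldPlot, coordDiff_foldPlot]
    by_cases hk : k = i
    · simp [hk, hs]
    · simp [hk]
  simp only [SmoothSymTensorField.restrict, ContinuousLinearMap.bilinearComp_apply, h, map_zero]

/-- If `H` is continuous, vanishes where the `i`-th coordinate is zero, and is a function `4 C` of the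
`j`-th coordinate alone on the open quadrant, then `C = 0`: let the `i`-th coordinate tend to `0`. -/
theorem eq_zero_of_continuous_of_eq_zero_on_edge {C : Ici (0 : ℝ) → ℝ} (hC : SmoothOnHalfLine C)
    {i j : Fin 2} (hij : i ≠ j) {H : EuclideanSpace ℝ (Fin 2) → ℝ} (hH : Continuous H)
    (h0 : ∀ s : EuclideanSpace ℝ (Fin 2), s i = 0 → H s = 0)
    (h1 : ∀ s : EuclideanSpace ℝ (Fin 2), (∀ k, 0 < s k) →
      H s = 4 * C (quadrantCoord j (foldPlot s))) : C = 0 := by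
  obtain ⟨g, hg, hgC⟩ := hC
  have hpos : ∀ y : ℝ, 0 < y → g y = 0 := by
    intro y hy
    let γ : ℝ → EuclideanSpace ℝ (Fin 2) := fun ε => WithLp.toLp 2 fun k => if k = i then ε else √y
    have hγ : Continuous γ := by
      refine (PiLp.continuous_toLp 2 _).comp (continuous_pi fun k => ?_)
      split_ifs <;> fun_prop
    have h2 : Tendsto (fun ε => H (γ ε)) (𝓝[>] 0) (𝓝 (H (γ 0))) :=
      ((hH.comp hγ).tendsto 0).mono_left nhdsWithin_le_nhds
    have h3 : (fun ε => H (γ ε)) =ᶠ[𝓝[>] 0] fun _ => 4 * g y := by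
      filter_upwards [self_mem_nhdsWithin] with ε hε
      rw [h1 _ fun k => ?_, ← hgC]
      · congr 2
        change (if j = i then ε else √y) ^ 2 = y
        rw [if_neg hij.symm, Real.sq_sqrt hy.le]
      · change 0 < if k = i then ε else √y
        split_ifs
        · exact hε
        · exact Real.sqrt_pos.2 hy
    have h4 := tendsto_nhds_unique (h2.congr' h3) tendsto_const_nhds
    rw [h0 _ (by simp [γ])] at h4
    linarith
  have hzero : ∀ y ∈ Ici (0 : ℝ), g y = 0 := by
    have h2 : EqOn g (fun _ => 0) (closure (Ioi 0)) :=
      EqOn.closure (fun y hy => hpos y hy) hg.continuous continuous_const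
    rwa [closure_Ioi] at h2
  funext y
  rw [← hgC, hzero y y.2]
  rfl

/-- No axial term survives: since `τ` itself is regular, `(A(y)/x) dx²` and `(B(x)/y) dy²` would be
restrictions of smooth tensors on the interior. -/
theorem IsDecomposition.eq_zero {τ ρ : DiffSymTensor quadrant} {A B : Ici (0 : ℝ) → ℝ}
    (h : IsDecomposition τ ρ A B) : ρ = τ ∧ A = 0 ∧ B = 0 := by
  have hreg := isRegularTensor τ
  let H : Fin 2 → EuclideanSpace ℝ (Fin 2) → ℝ := fun i s =>
    τ.val foldPlot isPlot_foldPlot s (EuclideanSpace.single i 1) (EuclideanSpace.single i 1) -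
      ρ.val foldPlot isPlot_foldPlot s (EuclideanSpace.single i 1) (EuclideanSpace.single i 1)
  have hH : ∀ i, Continuous (H i) := fun i =>
    ((((τ.smooth _ isPlot_foldPlot).clm_apply contDiff_const).clm_apply contDiff_const).sub
      (((ρ.smooth _ isPlot_foldPlot).clm_apply contDiff_const).clm_apply
        contDiff_const)).continuous
  have hH0 : ∀ i (s : EuclideanSpace ℝ (Fin 2)), s i = 0 → H i s = 0 := fun i s hs => by
    simp only [H, hreg.val_foldPlot_eq_zero hs, h.regular.val_foldPlot_eq_zero hs, sub_zero]
  have hA : A = 0 := by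
    refine eq_zero_of_continuous_of_eq_zero_on_edge h.smooth_A (i := 0) (j := 1) (by decide) (hH 0)
      (hH0 0) fun s hs => ?_
    have hs0 := hs 0
    have h1 := h.eq_interior foldPlot isPlot_foldPlot s (EuclideanSpace.single 0 1)
      (EuclideanSpace.single 0 1) (sq_pos_of_pos (hs 0)) (sq_pos_of_pos (hs 1))
    simp only [axialX, axialY, coordDiff_foldPlot] at h1
    have h2 : (quadrantCoord 0 (foldPlot s) : ℝ) = s 0 ^ 2 := rfl
    simp only [H, h1, h2]
    simp
    field_simp
    ring
  have hB : B = 0 := by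
    refine eq_zero_of_continuous_of_eq_zero_on_edge h.smooth_B (i := 1) (j := 0) (by decide) (hH 1)
      (hH0 1) fun s hs => ?_
    have hs1 := hs 1
    have h1 := h.eq_interior foldPlot isPlot_foldPlot s (EuclideanSpace.single 1 1)
      (EuclideanSpace.single 1 1) (sq_pos_of_pos (hs 0)) (sq_pos_of_pos (hs 1))
    simp only [axialX, axialY, coordDiff_foldPlot] at h1
    have h2 : (quadrantCoord 1 (foldPlot s) : ℝ) = s 1 ^ 2 := rfl
    simp only [H, h1, h2]
    simp
    field_simp
    ring
  refine ⟨DiffSymTensor.eq_of_eq_interior fun P hP r v w hr => ?_, hA, hB⟩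
  rw [h.eq_interior P hP r v w (hr 0) (hr 1)]
  simp [axialX, axialY, hA, hB]

end Regularity

/-- The zero tensor. -/
noncomputable instance {X : Type*} [DiffeologicalSpace X] : Zero (DiffSymTensor X) where
  zero :=
    { val := fun _ _ _ => 0
      smooth := fun _ _ => contDiff_const
      symm := fun _ _ _ _ _ => rfl
      pullback := fun _ _ _ _ _ _ _ => rfl }

theorem theorem4p1 (τ : DiffSymTensor quadrant) :
    (∃! d : DiffSymTensor quadrant × (Set.Ici (0 : ℝ) → ℝ) × (Set.Ici (0 : ℝ) → ℝ),
      IsDecomposition τ d.1 d.2.1 d.2.2) ∧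
    (∀ (ρ : DiffSymTensor quadrant) (A B : Set.Ici (0 : ℝ) → ℝ), IsDecomposition τ ρ A B →
      ∃ α β : DiffSymTensor quadrant, IsAxialX α A ∧ IsAxialY β B ∧ τ = ρ + α + β) ∧
    HasRegularMixedTerm τ := by
  refine ⟨⟨(τ, 0, 0), ?_, ?_⟩, ?_, hasRegularMixedTerm τ⟩
  · exact
      { regular := isRegularTensor τ
        smooth_A := ⟨0, contDiff_const, fun _ => rfl⟩
        smooth_B := ⟨0, contDiff_const, fun _ => rfl⟩
        eq_interior := fun P hP r v w _ _ => by simp [axialX, axialY] }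
  · rintro ⟨ρ, A, B⟩ h
    obtain ⟨h1, h2, h3⟩ := IsDecomposition.eq_zero h
    exact Prod.ext h1 (Prod.ext h2 h3)
  · intro ρ A B h
    obtain ⟨rfl, rfl, rfl⟩ := h.eq_zero
    refine ⟨0, 0, fun P hP r v w _ => ?_, fun P hP r v w _ => ?_, ?_⟩
    · simp only [axialX, Pi.zero_apply, zero_div, zero_mul]
      rfl
    · simp only [axialY, Pi.zero_apply, zero_div, zero_mul]
      rfl
    · apply DiffSymTensor.ext
      funext n P hP r
      ext v w
      change _ = ρ.val P hP r v w + 0 + 0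
      ring
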